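/- All quantum systems are finite-dimensional, a state is a positive semidefinite operator of unit trace, a channel is a completely positive trace-preserving linear map, and $k \ge 2$ is an integer. A state $\rho_{AB}$ is *$k$-extendible* (with respect to $B$) if there is a state $\omega_{AB_1\cdots B_k}$, with each $B_i \simeq B$, that is invariant under all permutations of $B_1,\dots,B_k$ and satisfies $\operatorname{Tr}_{B_2\cdots B_k}\{\omega_{AB_1\cdots B_k}\} = \rho_{AB}$. A bipartite channel $\mathcal{K}_{AB\to A'B'}$ is *$k$-extendible* if there is a channel $\mathcal{M}_{AB_1\cdots B_k\to A'B'_1\cdots B'_k}$, with each $B_i \simeq B$ and $B'_i\simeq B'$, such that, for all states $\theta_{AB_1\cdots B_k}$, $\mathcal{M}(\mathcal{W}^{\pi}_{B_1\cdots B_k}(\theta)) = \mathcal{W}^{\pi}_{B'_1\cdots B'_k}(\mathcal{M}(\theta))$ for every $\pi\in S_k$, where $\mathcal{W}^\pi$ is the unitary channel that permutes the $k$ systems by $\pi$, and $\operatorname{Tr}_{B'_2\cdots B'_k}\{\mathcal{M}(\theta_{AB_1\cdots B_k})\} = \mathcal{K}(\theta_{AB_1})$. Let $\mathcal{N}_{A\to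 B}$ be a channel and let $n, M$ be positive integers. A *quantum communication protocol employing $n$ uses of $\mathcal{N}$ interleaved by $k$-extendible channels* consists of systems $A'_i$, $B'_i$ ($1\le i\le n$) of arbitrary finite dimension and of $k$-extendible channels $\mathcal{K}^{(1)}_{\emptyset\to A'_1A_1B'_1}$, $\mathcal{K}^{(i)}_{A'_{i-1}B_{i-1}B'_{i-1}\to A'_iA_iB'_i}$ for $2\le i\le n$, and $\mathcal{K}^{(n+1)}_{A'_nB_nB'_n\to M_AM_B}$, where $A_i\simeq A$, $B_i\simeq B$, $|M_A|=|M_B|=M$, Alice holds $A'_i, A_i, M_A$ and Bob holds $B_i, B'_i, M_B$. Here $\mathcal{K}^{(1)}$ has trivial input and prepares a state $\rho^{(1)}$; one sets $\sigma^{(i)} = \mathcal{N}_{A_i\to B_i}(\rho^{(i)})$ for $1\le i\le n$, $\rho^{(i)} = \mathcal{K}^{(i)}(\sigma^{(i-1)})$ for $2\le i\le n$, and the final state is $\omega_{M_AM_B} = \mathcal{K}^{(n+1)}(\sigma^{(n)})$. It is an *$(n,M,\varepsilon)$ protocol* if $F(\omega_{M_AM_B},\Phi_{M_AM_B}) \ge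 1-\varepsilon$, where $F(\omega,\tau) = \|\sqrt{\omega}\sqrt{\tau}\|_1^2$ and $\Phi_{M_AM_B} = \frac1M\sum_{m,m'}|m\rangle\langle m'|\otimes|m\rangle\langle m'|$. **Statement.** Fix $\varepsilon\in[0,1-1/k)$. Let $\mathcal{N}_{A\to B}$ be a channel such that $\mathcal{N}_{A\to B}(\rho_{RA})$ is $k$-extendible with respect to $B$ for every finite-dimensional system $R$ and every input state $\rho_{RA}$. Then every $(n,M,\varepsilon)$ quantum communication protocol employing $n$ uses of $\mathcal{N}$ interleaved by $k$-extendible channels satisfies $$\frac{1}{n}\log_2 M \;\le\; \frac{1}{n}\log_2\!\left(\frac{1}{1-\frac{k}{k-1}\,\varepsilon}\right).$$ -/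

import Mathlib

open scoped Matrix ComplexOrder MatrixOrder

noncomputable section

/-! A finite-dimensional quantum system is represented by a finite type `A` labelling an orthonormal
basis, so that its Hilbert space is `ℂ^A`; operators are matrices `Matrix A A ℂ`, and the composite
of the systems `A` and `B` is `A × B`. -/

namespace QInfo

/-- Density operators: positive semidefinite with unit trace. -/
def IsState {A : Type*} [Fintype A] (ρ : Matrix A A ℂ) : Prop :=
  ρ.PosSemidef ∧ ρ.trace = 1

/-- Linear maps from operators on the system `A` to operators on the system `B`. -/
abbrev Superop (A B : Type*) : Type _ := Matrix A A ℂ →ₗ[ℂ] Matrix B B ℂ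

/-- The action of `id_R ⊗ N` on an operator of the composite system `R A`: `N` is applied to
each of the blocks `⟨r| X |s⟩`. -/
def idTensor {A B : Type*} (R : Type*) (N : Superop A B)
    (X : Matrix (R × A) (R × A) ℂ) : Matrix (R × B) (R × B) ℂ :=
  Matrix.of fun p q => N (Matrix.of fun a a' => X (p.1, a) (q.1, a')) p.2 q.2

/-- Quantum channels: completely positive (with respect to reference systems of every finite
dimension) and trace preserving linear maps. -/
structure IsChannel {A B : Type*} [Fintype A] [Fintype B] (N : Superop A B) : Prop where
  completelyPositive : ∀ (r : ℕ) (X : Matrix (Fin r × A) (Fin r × A) ℂ),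
    X.PosSemidef → (idTensor (Fin r) N X).PosSemidef
  tracePreserving : ∀ X : Matrix A A ℂ, (N X).trace = X.trace

/-- The partial trace over the second system. -/
def partialTrace {A E : Type*} [Fintype E] (X : Matrix (A × E) (A × E) ℂ) : Matrix A A ℂ :=
  Matrix.of fun a a' => ∑ e : E, X (a, e) (a', e)

/-- The marginal on `A B_i` of an operator on `A B_1 ⋯ B_k`: the systems `B_j` with `j ≠ i` are
traced out. The composite `B_1 ⋯ B_k` of `k` copies of `B` is the system `Fin k → B`. -/
def marginal {A B : Type*} [Fintype B] {k : ℕ} (i : Fin k)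
    (ω : Matrix (A × (Fin k → B)) (A × (Fin k → B)) ℂ) : Matrix (A × B) (A × B) ℂ :=
  let e : ((A × B) × ({j : Fin k // j ≠ i} → B)) → A × (Fin k → B) :=
    fun x => (x.1.1, (Equiv.funSplitAt i B).symm (x.1.2, x.2))
  partialTrace (ω.submatrix e e)

/-- The unitary permutation channel `ω ↦ W^π ω W^π†` on `A B_1 ⋯ B_k`, where `W^π` permutes the
`k` copies of `B`: it sends the basis vector `|a⟩|b⟩` to `|a⟩|b ∘ π⁻¹⟩`. -/
def permChannel {A B : Type*} {k : ℕ} (π : Equiv.Perm (Fin k))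
    (ω : Matrix (A × (Fin k → B)) (A × (Fin k → B)) ℂ) :
    Matrix (A × (Fin k → B)) (A × (Fin k → B)) ℂ :=
  ω.submatrix (fun x => (x.1, x.2 ∘ π)) (fun x => (x.1, x.2 ∘ π))

/-- The `k`-extendible states of `A B`, with respect to the system `B`. -/
def IsKExtendibleState {A B : Type*} [Fintype A] [Fintype B] (k : ℕ) [NeZero k]
    (ρ : Matrix (A × B) (A × B) ℂ) : Prop :=
  IsState ρ ∧ ∃ ω : Matrix (A × (Fin k → B)) (A × (Fin k → B)) ℂ,
    IsState ω ∧ (∀ π : Equiv.Perm (Fin k), permChannel π ω = ω) ∧ marginal 0 ω = ρ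

/-- The `k`-extendible bipartite channels `A B → A' B'`. -/
def IsKExtendibleChannel {A B A' B' : Type*} [Fintype A] [Fintype B] [Fintype A'] [Fintype B']
    (k : ℕ) [NeZero k] (K : Superop (A × B) (A' × B')) : Prop :=
  IsChannel K ∧ ∃ E : Superop (A × (Fin k → B)) (A' × (Fin k → B')),
    IsChannel E ∧
    (∀ (π : Equiv.Perm (Fin k)) (θ : Matrix (A × (Fin k → B)) (A × (Fin k → B)) ℂ),
      IsState θ → E (permChannel π θ) = permChannel π (E θ)) ∧
    (∀ θ : Matrix (A × (Fin k → B)) (A × (Fin k → B)) ℂ,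
      IsState θ → K (marginal 0 θ) = marginal 0 (E θ))

/-- Alice sends the system `A` of a state of `A' A B'` through `N : A → B`; the identity acts on
Alice's system `A'` and Bob's system `B'`. Before the use Alice holds `A' A` and Bob holds `B'`;
afterwards Alice holds `A'` and Bob holds `B B'`. -/
def useChannel {A B A' B' : Type*} (N : Superop A B)
    (ρ : Matrix ((A' × A) × B') ((A' × A) × B') ℂ) :
    Matrix (A' × (B × B')) (A' × (B × B')) ℂ :=
  let f : (A' × B') × A → (A' × A) × B' := fun x => ((x.1.1, x.2), x.1.2)
  let g : A' × (B × B') → (A' × B') × B := fun x => ((x.1, x.2.2), x.2.1)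
  (idTensor (A' × B') N (ρ.submatrix f f)).submatrix g g

/-- A quantum communication protocol that uses a channel with input `A` and output `B` a number
`n ≥ 1` of times, interleaved with `k`-extendible channels, and whose final systems have
dimension `M`. The channel uses are numbered `0, …, n - 1`. At the use `i`, Alice keeps a system
`A'_i` of dimension `dA i` and Bob keeps a system `B'_i` of dimension `dB i`. Nothing is required of
the values of `dA`, `dB` and `mid` at the indices that do not occur in the protocol. -/
structure Protocol (k : ℕ) [NeZero k] (A B : Type*) [Fintype A] [Fintype B] (n M : ℕ) where
  dA : ℕ → ℕ
  dB : ℕ → ℕ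
  /-- The first assisting channel, whose input systems are trivial. -/
  init : Superop (Unit × Unit) ((Fin (dA 0) × A) × Fin (dB 0))
  /-- The assisting channel between the channel uses `i` and `i + 1`. -/
  mid : ∀ i : ℕ, Superop (Fin (dA i) × (B × Fin (dB i)))
    ((Fin (dA (i + 1)) × A) × Fin (dB (i + 1)))
  /-- The last assisting channel, after the channel use `n - 1`. -/
  final : Superop (Fin (dA (n - 1)) × (B × Fin (dB (n - 1)))) (Fin M × Fin M)
  init_ext : IsKExtendibleChannel k init
  mid_ext : ∀ i : ℕ, i + 1 < n → IsKExtendibleChannel k (mid i)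
  final_ext : IsKExtendibleChannel k final

namespace Protocol

variable {k : ℕ} [NeZero k] {A B : Type*} [Fintype A] [Fintype B] {n M : ℕ}

/-- The state of `A'_i A B'_i` just before the use `i` of the channel `N`. The input of the first
assisting channel is the only state `1` of the trivial system. -/
def stateBefore (P : Protocol k A B n M) (N : Superop A B) :
    (i : ℕ) → Matrix ((Fin (P.dA i) × A) × Fin (P.dB i)) ((Fin (P.dA i) × A) × Fin (P.dB i)) ℂ
  | 0 => P.init 1
  | i + 1 => P.mid i (useChannel N (stateBefore P N i))

/-- The final state of the protocol, when it uses the channel `N`. -/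
def output (P : Protocol k A B n M) (N : Superop A B) :
    Matrix (Fin M × Fin M) (Fin M × Fin M) ℂ :=
  P.final (useChannel N (P.stateBefore N (n - 1)))

end Protocol

/-- The trace norm `‖X‖₁ = Tr √(X† X)`. -/
def traceNorm {A : Type*} [Fintype A] [DecidableEq A] (X : Matrix A A ℂ) : ℝ :=
  (CFC.sqrt (Xᴴ * X)).trace.re

/-- The fidelity `F(ρ, σ) = ‖√ρ √σ‖₁²`. -/
def fidelity {A : Type*} [Fintype A] [DecidableEq A] (ρ σ : Matrix A A ℂ) : ℝ :=
  traceNorm (CFC.sqrt ρ * CFC.sqrt σ) ^ 2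

/-- The maximally entangled state `(1/M) ∑_{m,m'} |m⟩⟨m'| ⊗ |m⟩⟨m'|` of Schmidt rank `M`. -/
def maxEntangled (M : ℕ) : Matrix (Fin M × Fin M) (Fin M × Fin M) ℂ :=
  (1 / (M : ℂ)) • ∑ m : Fin M, ∑ m' : Fin M, Matrix.single (m, m) (m', m') 1

/-- The protocol `P`, used with the channel `N`, is an `(n, M, ε)` protocol: its final state has
fidelity at least `1 - ε` to the maximally entangled state of Schmidt rank `M`. -/
def Protocol.Achieves {k : ℕ} [NeZero k] {A B : Type*} [Fintype A] [Fintype B] {n M : ℕ}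
    (P : Protocol k A B n M) (N : Superop A B) (ε : ℝ) : Prop :=
  1 - ε ≤ fidelity (P.output N) (maxEntangled M)

end QInfo

end

/-! The quantity to control is the overlap of the final state `ρ` with `Φ = maxEntangled M`. The
invariant `HasExtension` (one state on `A B_1 ⋯ B_k`, all of whose `A B_i` marginals equal the given
operator) survives every assisting channel and every use of `N`, so it holds for `ρ`, whatever `n`
is (`Protocol.hasExtension_output`).

Monogamy then bounds the overlap. With `ω` the extension of `ρ` and `P_i` the projection `Φ` on `A
B_i` tensored with the identity, `k Tr(ρ Φ) = Tr(ω ∑ P_i)`. With `F_ij` the swap of `B_i` and `B_j`,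
`P_i P_j = (1/M) F_ij P_j` for `i ≠ j` (`liftAt_maxEntangled_mul`), whence `P_i P_j + P_j P_i ≤
(1/M)(P_i + P_j)`. Summing gives `S² ≤ s S` for `S = ∑ P_i` and `s = 1 + (k-1)/M`, hence `S ≤ s` and
`k F(ρ, Φ) ≤ s`. Inserting `F ≥ 1 - ε` and solving for `M` gives the bound. -/

noncomputable section

namespace QInfo

/-! ### Extensions of states and their preservation -/

section Marginals

variable {A B : Type*} {k : ℕ}

/-- The splitting of `A B_1 ⋯ B_k` into `A B_i` and the remaining systems. -/
def marginalEquiv (A B : Type*) {k : ℕ} (i : Fin k) :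
    ((A × B) × ({j : Fin k // j ≠ i} → B)) ≃ A × (Fin k → B) :=
  (Equiv.prodAssoc _ _ _).trans (Equiv.prodCongr (Equiv.refl A) (Equiv.funSplitAt i B).symm)

theorem marginal_eq_partialTrace [Fintype B] (i : Fin k)
    (ω : Matrix (A × (Fin k → B)) (A × (Fin k → B)) ℂ) :
    marginal i ω = partialTrace (ω.submatrix (marginalEquiv A B i) (marginalEquiv A B i)) :=
  rfl

theorem marginal_apply [Fintype B] (i : Fin k)
    (ω : Matrix (A × (Fin k → B)) (A × (Fin k → B)) ℂ) (x y : A × B) :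
    marginal i ω x y = ∑ e : {j : Fin k // j ≠ i} → B,
      ω (x.1, (Equiv.funSplitAt i B).symm (x.2, e)) (y.1, (Equiv.funSplitAt i B).symm (y.2, e)) :=
  rfl

theorem marginal_permChannel [Fintype B] {i j : Fin k} (π : Equiv.Perm (Fin k)) (h : π i = j)
    (ω : Matrix (A × (Fin k → B)) (A × (Fin k → B)) ℂ) :
    marginal j (permChannel π ω) = marginal i ω := by
  subst h
  ext x y
  simp only [marginal_apply, permChannel, Matrix.submatrix_apply]
  let s : {l : Fin k // l ≠ i} ≃ {l : Fin k // l ≠ π i} :=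
    π.subtypeEquiv fun a => by simp
  have key : ∀ (b : B) (e : {l : Fin k // l ≠ π i} → B),
      (Equiv.funSplitAt (π i) B).symm (b, e) ∘ π = (Equiv.funSplitAt i B).symm (b, e ∘ s) := by
    intro b e
    ext l
    by_cases h : l = i
    · subst h; simp [Equiv.funSplitAt_symm_apply]
    · have h' : π l ≠ π i := fun hh => h (π.injective hh)
      simp [Equiv.funSplitAt_symm_apply, h, s, Equiv.subtypeEquiv_apply]
  exact Fintype.sum_equiv (Equiv.arrowCongr s.symm (Equiv.refl B)) _ _ fun e => by
    rw [key, key]; rfl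

theorem IsState.submatrix {A' : Type*} [Fintype A] [Fintype A'] {ρ : Matrix A A ℂ}
    (h : IsState ρ) (e : A' ≃ A) : IsState (ρ.submatrix e e) := by
  refine ⟨h.1.submatrix e, ?_⟩
  rw [← h.2]
  exact e.sum_comp fun a => ρ a a

theorem IsState.permChannel [Fintype A] [Fintype B] (π : Equiv.Perm (Fin k))
    {ω : Matrix (A × (Fin k → B)) (A × (Fin k → B)) ℂ} (h : IsState ω) :
    IsState (permChannel π ω) :=
  h.submatrix (Equiv.prodCongr (Equiv.refl A) (Equiv.arrowCongr π.symm (Equiv.refl B)))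

theorem IsChannel.isState [Fintype A] [Fintype B] {N : Superop A B} (hN : IsChannel N)
    {ρ : Matrix A A ℂ} (h : IsState ρ) : IsState (N ρ) := by
  refine ⟨?_, (hN.tracePreserving ρ).trans h.2⟩
  -- Positivity is complete positivity with a one-dimensional reference system.
  have := (hN.completelyPositive 1 _ (h.1.submatrix (Prod.snd : Fin 1 × A → A))).submatrix
    (fun b : B => ((0 : Fin 1), b))
  exact this

/-- The operator `ρ` of `A B` is the marginal on `A B_i`, for every `i`, of one state of
`A B_1 ⋯ B_k`. -/
def HasExtension [Fintype A] [Fintype B] (k : ℕ) (ρ : Matrix (A × B) (A × B) ℂ) : Prop :=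
  ∃ ω : Matrix (A × (Fin k → B)) (A × (Fin k → B)) ℂ, IsState ω ∧ ∀ i, marginal i ω = ρ

theorem HasExtension.posSemidef [Fintype A] [Fintype B] [NeZero k]
    {ρ : Matrix (A × B) (A × B) ℂ} (h : HasExtension k ρ) : ρ.PosSemidef := by
  obtain ⟨ω, hω, h⟩ := h
  have : ρ = ∑ e : {j : Fin k // j ≠ 0} → B,
      ω.submatrix (fun x => marginalEquiv A B 0 (x, e)) (fun x => marginalEquiv A B 0 (x, e)) := by
    ext x y
    rw [← h 0, Matrix.sum_apply]
    rfl
  rw [this]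
  exact Matrix.posSemidef_sum _ fun e _ => hω.1.submatrix _

theorem IsKExtendibleState.hasExtension [Fintype A] [Fintype B] [NeZero k]
    {ρ : Matrix (A × B) (A × B) ℂ} (h : IsKExtendibleState k ρ) : HasExtension k ρ := by
  obtain ⟨-, ω, hω, hsymm, hmarg⟩ := h
  refine ⟨ω, hω, fun i => ?_⟩
  rw [← hmarg, ← marginal_permChannel (Equiv.swap i 0) (Equiv.swap_apply_left i 0) ω, hsymm]

/-- Covariance under the swap of `i` and `0` carries the marginal condition from the copy `0` to the
copy `i`; the input extension need not be symmetric. -/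
theorem IsKExtendibleChannel.hasExtension {A' B' : Type*} [Fintype A] [Fintype B] [Fintype A']
    [Fintype B'] [NeZero k] {K : Superop (A × B) (A' × B')} (hK : IsKExtendibleChannel k K)
    {ρ : Matrix (A × B) (A × B) ℂ} (h : HasExtension k ρ) : HasExtension k (K ρ) := by
  obtain ⟨-, E, hE, hcov, hmarg⟩ := hK
  obtain ⟨ω, hω, hρ⟩ := h
  refine ⟨E ω, hE.isState hω, fun i => ?_⟩
  have hi := Equiv.swap_apply_left i (0 : Fin k)
  rw [← marginal_permChannel (Equiv.swap i 0) hi (E ω), ← hcov _ _ hω,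
    ← hmarg _ (hω.permChannel _), marginal_permChannel _ hi, hρ]

theorem hasExtension_one : HasExtension k (1 : Matrix (Unit × Unit) (Unit × Unit) ℂ) := by
  classical
  refine ⟨1, ⟨Matrix.PosSemidef.one, by simp⟩, fun i => ?_⟩
  ext x y
  rw [Subsingleton.elim x y, marginal_apply]
  simp

/-- If `N` produces only `k`-extendible states, then its use preserves the existence of extensions:
the extension is obtained by applying `N` with the reference system `A' B'_1 ⋯ B'_k`. -/
theorem HasExtension.useChannel {A' B' : Type*} [Fintype A] [Fintype B] [Fintype A']
    [Fintype B'] [NeZero k] {N : Superop A B}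
    (hext : ∀ (r : ℕ) (ρ : Matrix (Fin r × A) (Fin r × A) ℂ), IsState ρ →
      IsKExtendibleState k (idTensor (Fin r) N ρ))
    {ρ : Matrix ((A' × A) × B') ((A' × A) × B') ℂ} (h : HasExtension k ρ) :
    HasExtension k (useChannel N ρ) := by
  classical
  obtain ⟨ω, hω, hρ⟩ := h
  -- `hext` only speaks of references `Fin r`, so the reference is relabelled through `q`.
  let R := A' × (Fin k → B')
  let q : R ≃ Fin (Fintype.card R) := Fintype.equivFin R
  let f : Fin (Fintype.card R) × A ≃ (A' × A) × (Fin k → B') :=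
    { toFun := fun x => (((q.symm x.1).1, x.2), (q.symm x.1).2)
      invFun := fun x => (q (x.1.1, x.2), x.1.2)
      left_inv := fun x => by simp
      right_inv := fun x => by simp }
  obtain ⟨τ, hτ, hmarg⟩ := (hext _ _ (hω.submatrix f)).hasExtension
  -- Pairs the `l`-th copy of `B` from the extension `τ` of the output of `N` with the `l`-th copy
  -- of `B'` from `ω`.
  let g : A' × (Fin k → B × B') ≃ Fin (Fintype.card R) × (Fin k → B) :=
    { toFun := fun x => (q (x.1, fun l => (x.2 l).2), fun l => (x.2 l).1)
      invFun := fun x => ((q.symm x.1).1, fun l => (x.2 l, (q.symm x.1).2 l))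
      left_inv := fun x => by simp
      right_inv := fun x => by simp }
  refine ⟨τ.submatrix g g, hτ.submatrix g, fun i => ?_⟩
  ext ⟨a, b, c⟩ ⟨a', b', c'⟩
  have hg : ∀ (a : A') (b : B) (c : B') (e₁ : {l // l ≠ i} → B) (e₂ : {l // l ≠ i} → B'),
      g (a, (Equiv.funSplitAt i (B × B')).symm ((b, c), fun l => (e₁ l, e₂ l))) =
        (q (a, (Equiv.funSplitAt i B').symm (c, e₂)), (Equiv.funSplitAt i B).symm (b, e₁)) := by
    intro a b c e₁ e₂
    refine Prod.ext (congrArg q (Prod.ext rfl ?_)) ?_ <;>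
    · ext l
      by_cases h : l = i <;> simp [g, Equiv.funSplitAt_symm_apply, h]
  calc marginal i (τ.submatrix g g) (a, b, c) (a', b', c')
      = ∑ e₂ : {l // l ≠ i} → B', ∑ e₁ : {l // l ≠ i} → B,
        τ (q (a, (Equiv.funSplitAt i B').symm (c, e₂)), (Equiv.funSplitAt i B).symm (b, e₁))
          (q (a', (Equiv.funSplitAt i B').symm (c', e₂)),
            (Equiv.funSplitAt i B).symm (b', e₁)) := by
        rw [marginal_apply, Finset.sum_comm, ← Fintype.sum_prod_type']
        refine Fintype.sum_equiv (Equiv.arrowProdEquivProdArrow _ _ _) _ _ fun e => ?_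
        rw [Matrix.submatrix_apply]
        exact congrArg₂ τ (hg a b c (fun l => (e l).1) (fun l => (e l).2))
          (hg a' b' c' (fun l => (e l).1) (fun l => (e l).2))
    _ = ∑ e₂ : {l // l ≠ i} → B', idTensor _ N (ω.submatrix f f)
          (q (a, (Equiv.funSplitAt i B').symm (c, e₂)), b)
          (q (a', (Equiv.funSplitAt i B').symm (c', e₂)), b') := by
        refine Finset.sum_congr rfl fun e₂ _ => ?_
        rw [← hmarg i, marginal_apply]
    -- By linearity, tracing out the other copies of `B'` commutes with `N`, which brings in the
    -- marginal of `ω` on copy `i`.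
    _ = N (∑ e₂ : {l // l ≠ i} → B', Matrix.of fun x y =>
          ω ((a, x), (Equiv.funSplitAt i B').symm (c, e₂))
            ((a', y), (Equiv.funSplitAt i B').symm (c', e₂))) b b' := by
        rw [map_sum, Matrix.sum_apply]
        simp [idTensor, f]
    _ = QInfo.useChannel N ρ (a, b, c) (a', b', c') := by
        simp only [QInfo.useChannel, idTensor, Matrix.submatrix_apply, Matrix.of_apply]
        refine congrArg (fun X => N X b b') ?_
        ext x y
        rw [← hρ i, Matrix.sum_apply]
        simp only [Matrix.of_apply, marginal_apply]

end Marginals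

theorem Protocol.hasExtension_stateBefore {k : ℕ} [NeZero k] {A B : Type*} [Fintype A] [Fintype B]
    {n M : ℕ} {N : Superop A B}
    (hext : ∀ (r : ℕ) (ρ : Matrix (Fin r × A) (Fin r × A) ℂ), IsState ρ →
      IsKExtendibleState k (idTensor (Fin r) N ρ))
    (P : Protocol k A B n M) (i : ℕ) (hi : i < n) : HasExtension k (P.stateBefore N i) := by
  induction i with
  | zero => exact P.init_ext.hasExtension hasExtension_one
  | succ i ih => exact (P.mid_ext i hi).hasExtension ((ih (by omega)).useChannel hext)

theorem Protocol.hasExtension_output {k : ℕ} [NeZero k] {A B : Type*} [Fintype A] [Fintype B]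
    {n M : ℕ} {N : Superop A B}
    (hext : ∀ (r : ℕ) (ρ : Matrix (Fin r × A) (Fin r × A) ℂ), IsState ρ →
      IsKExtendibleState k (idTensor (Fin r) N ρ))
    (P : Protocol k A B n M) (hn : 0 < n) : HasExtension k (P.output N) :=
  P.final_ext.hasExtension
    ((P.hasExtension_stateBefore hext (n - 1) (by omega)).useChannel hext)

/-! ### The maximally entangled state and the fidelity to it -/

open scoped Kronecker

theorem maxEntangled_apply (M : ℕ) (x y : Fin M × Fin M) :
    maxEntangled M x y = if x.1 = x.2 ∧ y.1 = y.2 then 1 / (M : ℂ) else 0 := by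
  obtain ⟨a, b⟩ := x
  obtain ⟨c, d⟩ := y
  simp only [maxEntangled, Matrix.smul_apply, Matrix.sum_apply, Matrix.single_apply, smul_eq_mul,
    Prod.mk.injEq]
  by_cases h : a = b <;> by_cases h' : c = d
  · subst h h'
    simp only [and_self, if_true, ite_and]
    simp
  all_goals
    rw [Finset.sum_eq_zero, mul_zero, if_neg (by simp [h, h'])]
    intro m _
    refine Finset.sum_eq_zero fun m' _ => if_neg ?_
    rintro ⟨⟨h1, h2⟩, h3, h4⟩
    first
    | exact h (h1.symm.trans h2)
    | exact h' (h3.symm.trans h4)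

theorem isHermitian_maxEntangled (M : ℕ) : (maxEntangled M).IsHermitian := by
  ext x y
  simp only [Matrix.conjTranspose_apply, maxEntangled_apply, and_comm]
  split_ifs <;> simp

/-- The maximally entangled state is pure. -/
theorem maxEntangled_mul_mul (M : ℕ) (X : Matrix (Fin M × Fin M) (Fin M × Fin M) ℂ) :
    maxEntangled M * X * maxEntangled M = (X * maxEntangled M).trace • maxEntangled M := by
  ext x y
  simp only [Matrix.mul_apply, Matrix.smul_apply, smul_eq_mul, Matrix.trace, Matrix.diag,
    Finset.sum_mul, maxEntangled_apply]
  by_cases hx : x.1 = x.2 <;> by_cases hy : y.1 = y.2 <;> simp [hx, hy]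
  rw [Finset.sum_comm]
  refine Finset.sum_congr rfl fun u _ => ?_
  by_cases hu : u.1 = u.2 <;> simp only [hu, if_true, if_false, true_and, false_and,
    Finset.sum_const_zero]
  refine Finset.sum_congr rfl fun v _ => ?_
  split_ifs <;> ring

theorem trace_maxEntangled {M : ℕ} (hM : 0 < M) : (maxEntangled M).trace = 1 := by
  have : (M : ℂ) ≠ 0 := by exact_mod_cast hM.ne'
  simp [Matrix.trace, maxEntangled_apply, Fintype.sum_prod_type, this]

theorem maxEntangled_mul_self {M : ℕ} (hM : 0 < M) :
    maxEntangled M * maxEntangled M = maxEntangled M := by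
  have := maxEntangled_mul_mul M 1
  rwa [mul_one, one_mul, trace_maxEntangled hM, one_smul] at this

theorem posSemidef_of_isHermitian_of_mul_self {ι : Type*} [Fintype ι] {P : Matrix ι ι ℂ}
    (h : P.IsHermitian) (h' : P * P = P) : P.PosSemidef := by
  have := Matrix.posSemidef_conjTranspose_mul_self P
  rwa [h.eq, h'] at this

theorem posSemidef_maxEntangled {M : ℕ} (hM : 0 < M) : (maxEntangled M).PosSemidef :=
  posSemidef_of_isHermitian_of_mul_self (isHermitian_maxEntangled M) (maxEntangled_mul_self hM)

theorem trace_mul_nonneg {ι : Type*} [Fintype ι] {X Y : Matrix ι ι ℂ}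
    (hX : X.PosSemidef) (hY : Y.PosSemidef) : 0 ≤ (X * Y).trace := by
  classical
  obtain ⟨C, rfl⟩ := CStarAlgebra.nonneg_iff_eq_star_mul_self.mp hY.nonneg
  rw [← mul_assoc, Matrix.trace_mul_comm, ← mul_assoc]
  exact (hX.mul_mul_conjTranspose_same C).trace_nonneg

/-- Purity gives `(√ρ Φ)† (√ρ Φ) = Φ ρ Φ = f Φ` with `f = Tr(ρ Φ)`; its square root is `√f Φ`, of
trace `√f`. -/
theorem fidelity_maxEntangled {M : ℕ} (hM : 0 < M)
    {ρ : Matrix (Fin M × Fin M) (Fin M × Fin M) ℂ} (hρ : ρ.PosSemidef) :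
    fidelity ρ (maxEntangled M) = (ρ * maxEntangled M).trace.re := by
  have hΦ := posSemidef_maxEntangled hM
  have hnn := trace_mul_nonneg hρ hΦ
  obtain ⟨f, hf⟩ : ∃ f : ℝ, (ρ * maxEntangled M).trace = f :=
    ⟨_, Complex.ext rfl (Complex.nonneg_iff.mp hnn).2.symm⟩
  have hf0 : 0 ≤ f := by rw [hf] at hnn; exact_mod_cast hnn
  have hsΦ : CFC.sqrt (maxEntangled M) = maxEntangled M :=
    CFC.sqrt_unique (maxEntangled_mul_self hM) hΦ.nonneg
  have hsρ : (CFC.sqrt ρ)ᴴ = CFC.sqrt ρ := (CFC.sqrt_nonneg ρ).isSelfAdjoint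
  have hmul : (CFC.sqrt ρ * maxEntangled M)ᴴ * (CFC.sqrt ρ * maxEntangled M) =
      (f : ℂ) • maxEntangled M := by
    rw [Matrix.conjTranspose_mul, hsρ, (isHermitian_maxEntangled M).eq, mul_assoc,
      ← mul_assoc (CFC.sqrt ρ), CFC.sqrt_mul_sqrt_self ρ hρ.nonneg, ← mul_assoc,
      maxEntangled_mul_mul, hf]
  have hsqrt : CFC.sqrt ((f : ℂ) • maxEntangled M) = ((√f : ℝ) : ℂ) • maxEntangled M := by
    refine CFC.sqrt_unique ?_ (hΦ.smul ?_).nonneg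
    · rw [smul_mul_smul_comm, maxEntangled_mul_self hM, ← Complex.ofReal_mul,
        Real.mul_self_sqrt hf0]
    · exact_mod_cast Real.sqrt_nonneg f
  rw [fidelity, traceNorm, hsΦ, hmul, hsqrt, Matrix.trace_smul, trace_maxEntangled hM, hf]
  simp [Real.sq_sqrt hf0]

/-! ### Lifted projections and swaps on `A B_1 ⋯ B_k` -/

section Projections

/-- The operator `X` of `A B_i`, tensored with the identity of the remaining systems. -/
def liftAt {A B : Type*} [DecidableEq B] {k : ℕ} (i : Fin k) (X : Matrix (A × B) (A × B) ℂ) :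
    Matrix (A × (Fin k → B)) (A × (Fin k → B)) ℂ :=
  (X ⊗ₖ (1 : Matrix ({j : Fin k // j ≠ i} → B) ({j : Fin k // j ≠ i} → B) ℂ)).submatrix
    (marginalEquiv A B i).symm (marginalEquiv A B i).symm

variable {A B : Type*} [DecidableEq B] {k : ℕ}

theorem isHermitian_liftAt (i : Fin k) {X : Matrix (A × B) (A × B) ℂ} (hX : X.IsHermitian) :
    (liftAt i X).IsHermitian := by
  refine Matrix.IsHermitian.submatrix ?_ _
  rw [Matrix.IsHermitian, Matrix.conjTranspose_kronecker, hX.eq, Matrix.conjTranspose_one]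

/-- The unitary operator of `A B_1 ⋯ B_k` that swaps `B_i` and `B_j`. -/
def swapOp (A B : Type*) [DecidableEq A] [DecidableEq B] {k : ℕ} (i j : Fin k) :
    Matrix (A × (Fin k → B)) (A × (Fin k → B)) ℂ :=
  Matrix.of fun x y => if (x.1, x.2 ∘ Equiv.swap i j) = y then 1 else 0

theorem swapOp_comm [DecidableEq A] (i j : Fin k) : swapOp A B i j = swapOp A B j i := by
  rw [swapOp, Equiv.swap_comm]; rfl

theorem isHermitian_swapOp [DecidableEq A] (i j : Fin k) : (swapOp A B i j).IsHermitian := by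
  ext x y
  have : (y.1, y.2 ∘ Equiv.swap i j) = x ↔ (x.1, x.2 ∘ Equiv.swap i j) = y := by
    constructor <;> rintro rfl <;> simp [Function.comp_assoc, ← Equiv.coe_trans]
  simp only [Matrix.conjTranspose_apply, swapOp, Matrix.of_apply, this]
  split_ifs <;> simp

variable [Fintype A] [Fintype B]

theorem trace_mul_liftAt (i : Fin k) (ω : Matrix (A × (Fin k → B)) (A × (Fin k → B)) ℂ)
    (X : Matrix (A × B) (A × B) ℂ) :
    (ω * liftAt i X).trace = (marginal i ω * X).trace := by
  simp only [Matrix.trace, Matrix.diag, Matrix.mul_apply, liftAt]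
  rw [← (marginalEquiv A B i).sum_comp, Fintype.sum_prod_type]
  refine Finset.sum_congr rfl fun x _ => ?_
  simp_rw [marginal_eq_partialTrace, partialTrace, Matrix.of_apply, Finset.sum_mul]
  conv_rhs => rw [Finset.sum_comm]
  refine Finset.sum_congr rfl fun e _ => ?_
  rw [← (marginalEquiv A B i).sum_comp, Fintype.sum_prod_type]
  refine Finset.sum_congr rfl fun y _ => ?_
  simp [Matrix.one_apply]

theorem liftAt_mul (i : Fin k) (X Y : Matrix (A × B) (A × B) ℂ) :
    liftAt i X * liftAt i Y = liftAt i (X * Y) := by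
  rw [liftAt, liftAt, liftAt, Matrix.submatrix_mul_equiv, ← Matrix.mul_kronecker_mul, one_mul]

theorem liftAt_mulVec (i : Fin k) (X : Matrix (A × B) (A × B) ℂ) (v : A × (Fin k → B) → ℂ)
    (a : A) (b : Fin k → B) :
    (liftAt i X).mulVec v (a, b) =
      ∑ x : A × B, X (a, b i) x * v (x.1, Function.update b i x.2) := by
  simp only [Matrix.mulVec, dotProduct, liftAt]
  rw [← (marginalEquiv A B i).sum_comp, Fintype.sum_prod_type]
  refine Finset.sum_congr rfl fun x _ => ?_
  -- The identity factor keeps only the column that agrees with `b` away from `i`.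
  rw [Finset.sum_eq_single fun j : {j // j ≠ i} => b j]
  · have h1 : marginalEquiv A B i (x, fun j : {j // j ≠ i} => b j) =
        (x.1, Function.update b i x.2) := by
      refine Prod.ext rfl ?_
      ext l
      by_cases h : l = i
      · subst h; simp [marginalEquiv, Equiv.funSplitAt_symm_apply]
      · simp [marginalEquiv, Equiv.funSplitAt_symm_apply, h]
    have h2 : (marginalEquiv A B i).symm (a, b) = ((a, b i), fun j : {j // j ≠ i} => b j) := by
      simp [marginalEquiv]
    rw [Matrix.submatrix_apply, Equiv.symm_apply_apply, h2, h1]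
    simp
  · intro e _ he
    have h2 : (marginalEquiv A B i).symm (a, b) = ((a, b i), fun j : {j // j ≠ i} => b j) := by
      simp [marginalEquiv]
    rw [Matrix.submatrix_apply, Equiv.symm_apply_apply, h2]
    simp [he.symm]
  · simp

variable [DecidableEq A]

theorem swapOp_mulVec (i j : Fin k) (v : A × (Fin k → B) → ℂ) (x : A × (Fin k → B)) :
    (swapOp A B i j).mulVec v x = v (x.1, x.2 ∘ Equiv.swap i j) := by
  simp [Matrix.mulVec, dotProduct, swapOp]

theorem swapOp_mul_self (i j : Fin k) : swapOp A B i j * swapOp A B i j = 1 := by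
  refine Matrix.ext_of_mulVec_single fun z => ?_
  ext x
  rw [← Matrix.mulVec_mulVec, swapOp_mulVec, swapOp_mulVec]
  simp [Function.comp_assoc, ← Equiv.coe_trans, Matrix.one_apply, Pi.single_apply]

theorem swapOp_mul_liftAt_mul_swapOp (i j : Fin k) (X : Matrix (A × B) (A × B) ℂ) :
    swapOp A B i j * liftAt j X * swapOp A B i j = liftAt i X := by
  refine Matrix.ext_of_mulVec_single fun z => ?_
  ext ⟨a, b⟩
  rw [← Matrix.mulVec_mulVec, ← Matrix.mulVec_mulVec, swapOp_mulVec, liftAt_mulVec, liftAt_mulVec]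
  simp_rw [swapOp_mulVec]
  refine Finset.sum_congr rfl fun x _ => ?_
  have : Function.update (b ∘ Equiv.swap i j) j x.2 ∘ Equiv.swap i j = Function.update b i x.2 := by
    ext l
    simp only [Function.comp_apply, Function.update_apply, Equiv.swap_apply_self,
      Equiv.swap_apply_eq_iff, Equiv.swap_apply_right]
  rw [this]
  simp

end Projections

/-- A vector in the range of the projection at `j` vanishes unless `a = b j`, so the sum made by the
projection at `i` collapses to `m = b j`. This moves the entry `b j` to position `i`, as the swap
does, and leaves one factor `1 / M`. -/
theorem liftAt_maxEntangled_mul {k M : ℕ} {i j : Fin k} (hij : i ≠ j) :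
    liftAt i (maxEntangled M) * liftAt j (maxEntangled M) =
      (1 / (M : ℂ)) • (swapOp (Fin M) (Fin M) i j * liftAt j (maxEntangled M)) := by
  refine Matrix.ext_of_mulVec_single fun z => ?_
  generalize (Pi.single z 1 : Fin M × (Fin k → Fin M) → ℂ) = v
  have key : ∀ (l : Fin k) (w : Fin M × (Fin k → Fin M) → ℂ) (a : Fin M) (b : Fin k → Fin M),
      (liftAt l (maxEntangled M)).mulVec w (a, b) =
        if a = b l then 1 / (M : ℂ) * ∑ m : Fin M, w (m, Function.update b l m) else 0 := by
    intro l w a b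
    rw [liftAt_mulVec, Fintype.sum_prod_type]
    by_cases h : a = b l <;> simp [maxEntangled_apply, h, Finset.mul_sum]
  ext ⟨a, b⟩
  rw [← Matrix.mulVec_mulVec, Matrix.smul_mulVec, Pi.smul_apply, ← Matrix.mulVec_mulVec,
    swapOp_mulVec, key, key]
  simp_rw [key]
  have h1 : ∀ m, Function.update b i m j = b j := fun m => by
    rw [Function.update_of_ne hij.symm]
  have h2 : ∀ m, Function.update (b ∘ Equiv.swap i j) j m =
      Function.update (Function.update b i (b j)) j m := by
    intro m
    ext l
    by_cases hj : l = j
    · subst hj; simp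
    · by_cases hi : l = i
      · subst hi; simp [hj]
      · simp [hi, hj, Equiv.swap_apply_of_ne_of_ne]
  simp [h1, h2]

/-! ### Operator inequalities for sums of projections -/

/-- If a reflection `F` exchanges `P` and `Q`, and `P Q = c F Q`, then `P Q + Q P ≤ c (P + Q)`. -/
theorem posSemidef_smul_add_sub {ι : Type*} [Fintype ι] [DecidableEq ι] {P Q F : Matrix ι ι ℂ}
    {c : ℝ} (hc : 0 ≤ c) (hP : P.PosSemidef) (hF : F.IsHermitian) (hFF : F * F = 1)
    (hQ : F * P * F = Q) (hPQ : P * Q = (c : ℂ) • (F * Q)) (hQP : Q * P = (c : ℂ) • (F * P)) :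
    ((c : ℂ) • (P + Q) - (P * Q + Q * P)).PosSemidef := by
  -- As `F Q = P F`, both sides are `c (P + Q - P F - F P)`.
  have h : (c : ℂ) • (P + Q) - (P * Q + Q * P) = (c : ℂ) • ((1 - F)ᴴ * P * (1 - F)) := by
    have hFQ : F * Q = P * F := by
      rw [← hQ, ← mul_assoc, ← mul_assoc, hFF, one_mul]
    rw [hPQ, hQP, hFQ, Matrix.conjTranspose_sub, hF.eq, Matrix.conjTranspose_one, ← hQ,
      ← smul_add, ← smul_sub]
    congr 1
    noncomm_ring
  rw [h]
  exact (hP.conjTranspose_mul_mul_same _).smul (by exact_mod_cast hc)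

/-- If `S` is Hermitian and `S² ≤ s S` with `s > 0`, then `S ≤ s`. -/
theorem posSemidef_smul_one_sub {ι : Type*} [Fintype ι] [DecidableEq ι] {S : Matrix ι ι ℂ}
    {s : ℝ} (hs : 0 < s) (hS : S.IsHermitian) (h : ((s : ℂ) • S - S * S).PosSemidef) :
    ((s : ℂ) • (1 : Matrix ι ι ℂ) - S).PosSemidef := by
  have hT : ((s : ℂ) • (1 : Matrix ι ι ℂ) - S).IsHermitian := by
    refine Matrix.IsHermitian.sub ?_ hS
    rw [Matrix.IsHermitian, Matrix.conjTranspose_smul, Matrix.conjTranspose_one]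
    simp
  -- `s (s - S) = (s - S)² + (s S - S²)`.
  have h2 := Matrix.posSemidef_conjTranspose_mul_self ((s : ℂ) • (1 : Matrix ι ι ℂ) - S)
  have h3 := (h2.add h).smul (show (0 : ℂ) ≤ ((s⁻¹ : ℝ) : ℂ) by exact_mod_cast (inv_pos.2 hs).le)
  convert h3 using 1
  have hs' : (s : ℂ) ≠ 0 := by exact_mod_cast hs.ne'
  rw [hT.eq, eq_comm, Complex.ofReal_inv, inv_smul_eq_iff₀ hs']
  simp only [sub_mul, mul_sub, smul_mul_assoc, mul_smul_comm, one_mul, mul_one, smul_sub]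
  abel

/-- Orthogonal projections whose pairwise products are controlled by `c` have a sum of norm at
most `1 + (k - 1) c`. -/
theorem posSemidef_smul_one_sub_sum {ι : Type*} [Fintype ι] [DecidableEq ι] {k : ℕ} (hk : 0 < k)
    {P : Fin k → Matrix ι ι ℂ} {c : ℝ} (hc : 0 ≤ c) (hP : ∀ i, (P i).IsHermitian)
    (hPP : ∀ i, P i * P i = P i)
    (hPQ : ∀ i j, i ≠ j → ((c : ℂ) • (P i + P j) - (P i * P j + P j * P i)).PosSemidef) :
    (((1 + ((k : ℝ) - 1) * c : ℝ) : ℂ) • (1 : Matrix ι ι ℂ) - ∑ i, P i).PosSemidef := by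
  have hk' : (1 : ℝ) ≤ k := by exact_mod_cast hk
  have hs : 0 < 1 + ((k : ℝ) - 1) * c := by nlinarith
  have hS : (∑ i, P i).IsHermitian := by
    rw [Matrix.IsHermitian, Matrix.conjTranspose_sum]
    exact Finset.sum_congr rfl fun i _ => hP i
  refine posSemidef_smul_one_sub hs hS ?_
  have hsum : (∑ i, ∑ j, if i = j then 0 else
      ((c : ℂ) • (P i + P j) - (P i * P j + P j * P i))).PosSemidef := by
    refine Matrix.posSemidef_sum _ fun i _ => Matrix.posSemidef_sum _ fun j _ => ?_
    split_ifs with h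
    · exact Matrix.PosSemidef.zero
    · exact hPQ i j h
  -- The double sum runs over ordered pairs, so it counts each pair twice; half of it is `(k - 1) c
  -- S - (S² - S)`.
  have h2 := hsum.smul (show (0 : ℂ) ≤ ((2⁻¹ : ℝ) : ℂ) by exact_mod_cast (by norm_num))
  convert h2 using 1
  -- At `i = j` the general term equals `(2c - 2) P i`; subtracting it lets the double sum run over
  -- all pairs.
  have hterm : ∀ i j, (if i = j then 0 else
      ((c : ℂ) • (P i + P j) - (P i * P j + P j * P i))) =
      ((c : ℂ) • (P i + P j) - (P i * P j + P j * P i)) -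
        if i = j then (2 * (c : ℂ) - 2) • P i else 0 := by
    intro i j
    split_ifs with h
    · subst h
      rw [hPP, ← two_smul ℂ (P i), smul_smul, ← sub_smul, mul_comm (c : ℂ), sub_self]
    · rw [sub_zero]
  simp_rw [hterm]
  simp only [Finset.sum_sub_distrib, Finset.sum_add_distrib, smul_add, Finset.sum_ite_eq,
    Finset.mem_univ, if_true, Finset.sum_const, Finset.card_univ, Fintype.card_fin,
    ← Finset.smul_sum, ← Finset.mul_sum, ← Finset.sum_mul]
  rw [← Nat.cast_smul_eq_nsmul ℂ]
  generalize ∑ i, P i = S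
  push_cast
  module

/-! ### The fidelity bound and the conclusion -/

/-- The fidelity of a state with a `k`-extension to the maximally entangled state. -/
theorem HasExtension.fidelity_maxEntangled_le {k M : ℕ} (hk : 0 < k) (hM : 0 < M)
    {ρ : Matrix (Fin M × Fin M) (Fin M × Fin M) ℂ} (hρ : ρ.PosSemidef) (h : HasExtension k ρ) :
    k * fidelity ρ (maxEntangled M) ≤ 1 + ((k : ℝ) - 1) * (1 / M) := by
  obtain ⟨ω, hω, hmarg⟩ := h
  have hΦ := maxEntangled_mul_self hM
  have hH := isHermitian_maxEntangled M
  have hherm := fun i : Fin k => isHermitian_liftAt i hH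
  have hidem : ∀ i : Fin k, liftAt i (maxEntangled M) * liftAt i (maxEntangled M) =
      liftAt i (maxEntangled M) := fun i => by rw [liftAt_mul, hΦ]
  have key := posSemidef_smul_one_sub_sum hk (c := 1 / (M : ℝ)) (by positivity) hherm hidem
    fun i j hij => posSemidef_smul_add_sub (by positivity)
      (posSemidef_of_isHermitian_of_mul_self (hherm i) (hidem i)) (isHermitian_swapOp i j)
      (swapOp_mul_self i j) (by rw [swapOp_comm]; exact swapOp_mul_liftAt_mul_swapOp j i _)
      (by rw [liftAt_maxEntangled_mul hij]; push_cast; rfl)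
      (by rw [liftAt_maxEntangled_mul hij.symm, swapOp_comm]; push_cast; rfl)
  -- Pairing with `ω` turns each lifted projection into `Tr(ρ Φ)`, since all marginals equal `ρ`.
  have htr := trace_mul_nonneg hω.1 key
  simp only [mul_sub, Matrix.trace_sub, Finset.mul_sum, Matrix.trace_sum, trace_mul_liftAt, hmarg,
    mul_smul_comm, mul_one, Matrix.trace_smul, hω.2, Finset.sum_const, Finset.card_univ,
    Fintype.card_fin, smul_eq_mul, nsmul_eq_mul] at htr
  have hre := (Complex.nonneg_iff.mp htr).1
  rw [fidelity_maxEntangled hM hρ]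
  simpa using hre

end QInfo

end

theorem mainTheorem6 (k : ℕ) [NeZero k] (hk : 2 ≤ k)
    (ε : ℝ) (hε0 : 0 ≤ ε) (hε1 : ε < 1 - 1 / (k : ℝ))
    {A B : Type*} [Fintype A] [Fintype B]
    (N : QInfo.Superop A B) (hN : QInfo.IsChannel N)
    (hext : ∀ (r : ℕ) (ρ : Matrix (Fin r × A) (Fin r × A) ℂ), QInfo.IsState ρ →
      QInfo.IsKExtendibleState k (QInfo.idTensor (Fin r) N ρ))
    (n M : ℕ) (hn : 0 < n) (hM : 0 < M)
    (P : QInfo.Protocol k A B n M) (hP : P.Achieves N ε) :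
    1 / (n : ℝ) * Real.logb 2 (M : ℝ) ≤
      1 / (n : ℝ) * Real.logb 2 (1 / (1 - (k : ℝ) / ((k : ℝ) - 1) * ε)) := by
  have hk2 : (2 : ℝ) ≤ k := by exact_mod_cast hk
  have hM0 : (0 : ℝ) < M := by exact_mod_cast hM
  have hk0 : (0 : ℝ) < k := by linarith
  have hk1 : (0 : ℝ) < (k : ℝ) - 1 := by linarith
  have hout := P.hasExtension_output hext hn
  have hfid := hout.fidelity_maxEntangled_le (by omega) hM hout.posSemidef
  have hach : 1 - ε ≤ QInfo.fidelity (P.output N) (QInfo.maxEntangled M) := hP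
  have hbound : (k : ℝ) * (1 - ε) ≤ 1 + ((k : ℝ) - 1) * (1 / M) :=
    (mul_le_mul_of_nonneg_left hach hk0.le).trans hfid
  have hle : 1 - (k : ℝ) / ((k : ℝ) - 1) * ε ≤ 1 / M := by
    have : 1 - (k : ℝ) / ((k : ℝ) - 1) * ε = ((k : ℝ) - 1 - k * ε) / ((k : ℝ) - 1) := by
      field_simp
    rw [this, div_le_iff₀ hk1]
    linarith
  -- Here `ε < 1 - 1/k` enters: it makes the denominator positive, so the inequality can be
  -- inverted.
  have hpos : 0 < 1 - (k : ℝ) / ((k : ℝ) - 1) * ε := by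
    have : (k : ℝ) * ε < k - 1 := by
      have := mul_lt_mul_of_pos_left hε1 hk0
      rwa [mul_sub, mul_one_div_cancel hk0.ne', mul_one] at this
    rw [sub_pos, div_mul_eq_mul_div, div_lt_one hk1]
    exact this
  refine mul_le_mul_of_nonneg_left ?_ (by positivity)
  refine Real.logb_le_logb_of_le one_lt_two hM0 ?_
  rw [le_div_comm₀ hM0 hpos]
  exact hle
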